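/- Let $(X,\mu)$ be a $\sigma$-finite measure space, $\mathcal H=L^2_\mu(X)$, and let $\omega:X\to\mathbb R$ be measurable with $\omega(k)\ge m$ for all $k\in X$, for some $m>0$. For $s\in\mathbb R$ let $\mathcal H_s$ be the space of (classes of) measurable functions $\psi:X\to\mathbb C$ with $\|\psi\|_s^2=\int\omega(k)^s|\psi(k)|^2\,\mathrm d\mu<\infty$. Let $\mathcal F$ be the symmetric Fock space over $\mathcal H$, that is, the space of sequences $\Psi=(\Psi^{(n)})_{n\in\mathbb N}$ of permutation symmetric functions $\Psi^{(n)}$ on $X^n$ with $\|\Psi\|_{\mathcal F}^2=\sum_n\int|\Psi^{(n)}|^2\,\mathrm d^n\mu<\infty$. For $s\in\mathbb R$ let $\mathcal F_s$ be the space of the scale of $\mathrm d\Gamma(\omega)$, that is, of sequences of permutation symmetric functions with $$\|\Psi\|_{\mathcal F_s}^2=\sum_n\int\Bigl(1+\sum_{j=1}^n\omega(k_j)\Bigr)^s|\Psi^{(n)}(k_1,\dots,k_n)|^2\,\mathrm d^n\mu<\infty ,$$ and let $(\Theta,\Phi)_{\mathcal F_{-s},\mathcal F_s}=\langle(\mathrm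 d\Gamma(\omega)+1)^{-s/2}\Theta,(\mathrm d\Gamma(\omega)+1)^{s/2}\Phi\rangle_{\mathcal F}$ be the duality pairing of $\mathcal F_{-s}$ and $\mathcal F_s$. For $s\ge1$ and $f\in\mathcal H_{-s}$, the annihilation operator $a(f)\in\mathcal B(\mathcal F_s,\mathcal F)$ is the bounded operator acting as $$(a(f)\Psi)^{(n)}(k_1,\dots,k_n)=\sqrt{n+1}\int\overline{f(x)}\,\Psi^{(n+1)}(k_1,\dots,k_n,x)\,\mathrm d\mu(x)\qquad(n\ge0),$$ and the creation operator $a^\dagger(f)\in\mathcal B(\mathcal F,\mathcal F_{-s})$ is its adjoint, that is, the bounded operator with $\langle\Psi,a(f)\Phi\rangle_{\mathcal F}=(a^\dagger(f)\Psi,\Phi)_{\mathcal F_{-s},\mathcal F_s}$ for all $\Psi\in\mathcal F$, $\Phi\in\mathcal F_s$. (Each of the two operators is uniquely determined by its property.) Proposition 3.4. Let $s\ge1$ and $f\in\mathcal H_{-s}$. Then the operators $a(f)$ and $a^\dagger(f)$ exist, and there is a sequence $(f^i)_{i\in\mathbb N}\subset\mathcal H$ such that the operators $a(f^i)$ and $a^\dagger(f^i)$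 exist for all $i$ and $$\lim_{i\to\infty}\|a(f)-a(f^i)\|_{\mathcal B(\mathcal F_s,\mathcal F)}=0,\qquad\lim_{i\to\infty}\|a^\dagger(f)-a^\dagger(f^i)\|_{\mathcal B(\mathcal F,\mathcal F_{-s})}=0 .$$ -/

import Mathlib

open MeasureTheory Filter Topology

noncomputable section

namespace FockScale

variable {X : Type*} [MeasurableSpace X]

/-! ### The one-particle scale -/

/-- The space `H_s` of the scale of the multiplication operator by `ω`, for any real `s`:
(classes of) functions `ψ` with `‖ψ‖² = ∫ ω ^ s * |ψ| ^ 2 dμ` finite. -/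
abbrev OneParticle (μ : Measure X) (ω : X → ℝ) (s : ℝ) : Type _ :=
  Lp ℂ 2 (μ.withDensity fun x => ENNReal.ofReal (ω x ^ s))

/-! ### Symmetric Fock spaces -/

/-- Permutation of the `n` variables. -/
def permute {n : ℕ} (σ : Equiv.Perm (Fin n)) (k : Fin n → X) : Fin n → X := fun i => k (σ i)

/-- Given for each `n` a permutation invariant measure `ν n` on `X ^ n`, the Hilbert sum over `n`
of the spaces of symmetric functions in `L² (X ^ n, ν n)`. -/
def symmetricSum (ν : ∀ n : ℕ, Measure (Fin n → X))
    (hν : ∀ (n : ℕ) (σ : Equiv.Perm (Fin n)), MeasurePreserving (permute σ) (ν n) (ν n)) :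
    Submodule ℂ (lp (fun n : ℕ => Lp ℂ 2 (ν n)) 2) where
  carrier := {Ψ | ∀ (n : ℕ) (σ : Equiv.Perm (Fin n)),
    Lp.compMeasurePreserving (permute σ) (hν n σ) (Ψ n) = Ψ n}
  add_mem' := by
    intro Ψ Φ hΨ hΦ n σ
    have h1 := hΨ n σ
    have h2 := hΦ n σ
    rw [lp.coeFn_add, Pi.add_apply, map_add, h1, h2]
  zero_mem' := by
    intro n σ
    rw [lp.coeFn_zero, Pi.zero_apply, map_zero]
  smul_mem' := by
    intro c Ψ hΨ n σ
    have h1 := hΨ n σ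
    rw [lp.coeFn_smul, Pi.smul_apply]
    have h2 := (Lp.compMeasurePreservingₗ ℂ (permute σ) (hν n σ) (E := ℂ) (p := 2)).map_smul c (Ψ n)
    exact h2.trans (congrArg (c • ·) h1)

/-- The measure `dⁿμ` on `X ^ n` (the unit mass on the one-point space if `n = 0`). -/
abbrev power (μ : Measure X) (n : ℕ) : Measure (Fin n → X) := Measure.pi fun _ : Fin n => μ

theorem measurePreserving_permute (μ : Measure X) [SigmaFinite μ] (n : ℕ)
    (σ : Equiv.Perm (Fin n)) : MeasurePreserving (permute σ) (power μ n) (power μ n) := by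
  have h := measurePreserving_piCongrLeft (α := fun _ : Fin n => X) (fun _ => μ) σ.symm
  convert h using 1
  funext k i
  have := MeasurableEquiv.piCongrLeft_apply_apply (β := fun _ : Fin n => X) σ.symm k (σ i)
  simpa [permute] using this.symm

/-- `1 + ω(k₁) + ⋯ + ω(kₙ)`: the operator `dΓ(ω) + 1` on the `n`-particle sector is the
multiplication by this function. -/
def weight (ω : X → ℝ) {n : ℕ} (k : Fin n → X) : ℝ := 1 + ∑ j, ω (k j)

/-- The measure `(1 + ω(k₁) + ⋯ + ω(kₙ)) ^ s dⁿμ` on `X ^ n`. -/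
abbrev weightedPower (μ : Measure X) (ω : X → ℝ) (s : ℝ) (n : ℕ) : Measure (Fin n → X) :=
  (power μ n).withDensity fun k => ENNReal.ofReal (weight ω k ^ s)

theorem weight_permute {X : Type*} (ω : X → ℝ) {n : ℕ} (σ : Equiv.Perm (Fin n)) (k : Fin n → X) :
    weight ω (permute σ k) = weight ω k := by
  simp only [weight, permute]
  rw [Equiv.sum_comp σ fun i => ω (k i)]

theorem measurePreserving_permute_weighted (μ : Measure X) [SigmaFinite μ] (ω : X → ℝ) (s : ℝ)
    (n : ℕ) (σ : Equiv.Perm (Fin n)) :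
    MeasurePreserving (permute σ) (weightedPower μ ω s n) (weightedPower μ ω s n) := by
  have h := measurePreserving_permute μ n σ
  have hemb : MeasurableEmbedding (permute σ : (Fin n → X) → Fin n → X) := by
    refine MeasurableEmbedding.of_measurable_inverse (g := permute σ.symm) h.measurable ?_
      (measurePreserving_permute μ n σ.symm).measurable ?_
    · rw [Set.range_eq_univ.2]
      · exact MeasurableSet.univ
      · intro k
        exact ⟨permute σ.symm k, by funext i; simp [permute]⟩
    · intro k
      funext i
      simp [permute]
  refine ⟨h.measurable, ?_⟩
  ext N hN
  rw [Measure.map_apply h.measurable hN, withDensity_apply _ (h.measurable hN),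
    withDensity_apply _ hN]
  have h2 := h.setLIntegral_comp_preimage_emb hemb
    (fun k => ENNReal.ofReal (weight ω k ^ s)) N
  simp only [weight_permute] at h2
  exact h2

/-- The symmetric Fock space `F` over `H = L²(X, μ)`: sequences `Ψ = (Ψ⁽ⁿ⁾)` of symmetric functions
`Ψ⁽ⁿ⁾` on `X ^ n` with `‖Ψ‖² = ∑ₙ ∫ |Ψ⁽ⁿ⁾|² dⁿμ` finite. -/
abbrev Fock (μ : Measure X) [SigmaFinite μ] : Type _ :=
  symmetricSum (power μ) (measurePreserving_permute μ)

/-- The space `F_s` of the scale of `dΓ(ω)`, for any real `s`: sequences `Ψ = (Ψ⁽ⁿ⁾)` of symmetric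
functions with `‖Ψ‖² = ∑ₙ ∫ (1 + ω(k₁) + ⋯ + ω(kₙ)) ^ s * |Ψ⁽ⁿ⁾(k)|² dⁿμ(k)` finite. -/
abbrev FockS (μ : Measure X) [SigmaFinite μ] (ω : X → ℝ) (s : ℝ) : Type _ :=
  symmetricSum (weightedPower μ ω s) (measurePreserving_permute_weighted μ ω s)

/-- The duality pairing of `F_{-s}` and `F_s`,
`⟨(dΓ(ω) + 1) ^ (-s/2) Θ, (dΓ(ω) + 1) ^ (s/2) Φ⟩` with the scalar product of `F`. -/
def pairing {μ : Measure X} [SigmaFinite μ] {ω : X → ℝ} {s : ℝ}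
    (Θ : FockS μ ω (-s)) (Φ : FockS μ ω s) : ℂ :=
  ∑' n : ℕ, ∫ k, (starRingEnd ℂ) (((weight ω k ^ (-s / 2) : ℝ) : ℂ) * Θ.1 n k) *
    (((weight ω k ^ (s / 2) : ℝ) : ℂ) * Φ.1 n k) ∂(power μ n)

/-! ### Annihilation and creation operators on the scale -/

/-- The bounded operator `A : F_s → F` is the annihilation operator `a(f)`:
`(A Ψ)⁽ⁿ⁾(k₁, …, kₙ) = √(n+1) ∫ conj (f x) Ψ⁽ⁿ⁺¹⁾(k₁, …, kₙ, x) dμ(x)` for all `n`, the integral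
being absolutely convergent for almost all `(k₁, …, kₙ)`. (So `A Ω = 0` for the vacuum `Ω`.) -/
def IsAnnihilation {μ : Measure X} [SigmaFinite μ] {ω : X → ℝ} {s : ℝ} (f : X → ℂ)
    (A : FockS μ ω s →L[ℂ] Fock μ) : Prop :=
  ∀ (Ψ : FockS μ ω s) (n : ℕ), ∀ᵐ k ∂(power μ n),
    Integrable (fun x => (starRingEnd ℂ) (f x) * Ψ.1 (n + 1) (Fin.snoc (α := fun _ => X) k x)) μ ∧
    (A Ψ).1 n k = (√((n : ℝ) + 1) : ℂ) *
      ∫ x, (starRingEnd ℂ) (f x) * Ψ.1 (n + 1) (Fin.snoc (α := fun _ => X) k x) ∂μ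

/-- The bounded operator `B : F → F_{-s}` is the creation operator `a†(f)`: it is the adjoint of the
annihilation operator `a(f) : F_s → F` for the duality of `F_{-s}` and `F_s`. -/
def IsCreation {μ : Measure X} [SigmaFinite μ] {ω : X → ℝ} {s : ℝ} (f : X → ℂ)
    (B : Fock μ →L[ℂ] FockS μ ω (-s)) : Prop :=
  ∃ A : FockS μ ω s →L[ℂ] Fock μ, IsAnnihilation f A ∧
    ∀ (Ψ : Fock μ) (Φ : FockS μ ω s), inner ℂ Ψ (A Φ) = pairing (B Ψ) Φ

/-- There is at most one annihilation operator `a(f) : F_s → F`. -/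
theorem IsAnnihilation.unique {μ : Measure X} [SigmaFinite μ] {ω : X → ℝ} {s : ℝ} {f : X → ℂ}
    {A A' : FockS μ ω s →L[ℂ] Fock μ} (h : IsAnnihilation f A) (h' : IsAnnihilation f A') :
    A = A' := by
  ext Ψ : 1
  apply Subtype.ext
  apply lp.ext
  funext n
  apply Lp.ext
  filter_upwards [h Ψ n, h' Ψ n] with k hk hk'
  rw [hk.2, hk'.2]

/-- The pairing of `F_{-s}` and `F_s` separates the points of `F_{-s}`. -/
theorem pairing_separates {μ : Measure X} [SigmaFinite μ] {ω : X → ℝ} (hω : Measurable ω)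
    (hpos : ∀ x, 0 ≤ ω x) {s : ℝ} {Θ Θ' : FockS μ ω (-s)}
    (h : ∀ Φ : FockS μ ω s, pairing Θ Φ = pairing Θ' Φ) : Θ = Θ' := by
  apply Subtype.ext
  apply lp.ext
  funext n
  have hW : ∀ k : Fin n → X, 0 < weight ω k := fun k => by
    have : 0 ≤ ∑ j, ω (k j) := Finset.sum_nonneg fun j _ => hpos _
    unfold weight
    linarith
  have hWm : Measurable (weight ω : (Fin n → X) → ℝ) := by
    unfold weight
    fun_prop
  have hdm : ∀ t : ℝ, Measurable fun k : Fin n → X => ENNReal.ofReal (weight ω k ^ t) := fun t =>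
    (hWm.pow_const t).ennreal_ofReal
  have hac : ∀ t t' : ℝ, weightedPower μ ω t n ≪ weightedPower μ ω t' n := fun t t' =>
    (withDensity_absolutelyContinuous _ _).trans
      (withDensity_absolutelyContinuous' (hdm t').aemeasurable
        (Eventually.of_forall fun k => by
          have := Real.rpow_pos_of_pos (hW k) t'
          simpa using this))
  set D : Lp ℂ 2 (weightedPower μ ω (-s) n) := Θ.1 n - Θ'.1 n with hD
  have hDsymm : ∀ σ : Equiv.Perm (Fin n), (fun k => D (permute σ k)) =ᵐ[weightedPower μ ω (-s) n] D := by
    intro σ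
    have h1 : Lp.compMeasurePreserving (permute σ)
        (measurePreserving_permute_weighted μ ω (-s) n σ) D = D := by
      rw [hD, map_sub, Θ.2 n σ, Θ'.2 n σ]
    have h2 := Lp.coeFn_compMeasurePreserving D
      (measurePreserving_permute_weighted μ ω (-s) n σ)
    rw [h1] at h2
    exact h2.symm
  let u : (Fin n → X) → ℂ := fun k => ((weight ω k ^ (-s) : ℝ) : ℂ) * D k
  have hum : AEStronglyMeasurable u (weightedPower μ ω s n) := by
    refine AEStronglyMeasurable.mul ?_ ((Lp.aestronglyMeasurable D).mono_ac (hac _ _))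
    exact (Complex.measurable_ofReal.comp (hWm.pow_const (-s))).aestronglyMeasurable
  have hu : MemLp u 2 (weightedPower μ ω s n) := by
    rw [memLp_two_iff_integrable_sq_norm hum]
    have h1 := (memLp_two_iff_integrable_sq_norm (Lp.aestronglyMeasurable D)).1 (Lp.memLp D)
    rw [integrable_withDensity_iff_integrable_smul' (hdm _)
      (Eventually.of_forall fun k => ENNReal.ofReal_lt_top)] at h1 ⊢
    refine h1.congr (Eventually.of_forall fun k => ?_)
    have hp := fun t : ℝ => (Real.rpow_pos_of_pos (hW k) t)
    simp only [u, norm_mul, Complex.norm_real, Real.norm_eq_abs, abs_of_pos (hp _),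
      ENNReal.toReal_ofReal (hp _).le, smul_eq_mul]
    have h3 : weight ω k ^ s * weight ω k ^ (-s) = 1 := by
      rw [← Real.rpow_add (hW k)]; simp
    linear_combination (-(weight ω k ^ (-s)) * ‖D k‖ ^ 2) * h3
  have hsymm : ∀ σ : Equiv.Perm (Fin n), Lp.compMeasurePreserving (permute σ)
      (measurePreserving_permute_weighted μ ω s n σ) (hu.toLp u) = hu.toLp u := by
    intro σ
    rw [Lp.toLp_compMeasurePreserving]
    apply MemLp.toLp_congr
    filter_upwards [(hac s (-s)).ae_le (hDsymm σ)] with k hk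
    simp only [Function.comp, u, weight_permute]
    rw [hk]
  let Φ : FockS μ ω s := ⟨lp.single 2 n (hu.toLp u), by
    intro j σ
    by_cases hj : j = n
    · subst hj
      rw [lp.single_apply_self]
      exact hsymm σ
    · rw [lp.single_apply_ne _ _ _ hj, map_zero]⟩
  have key : ∀ Ξ : FockS μ ω (-s), pairing Ξ Φ = inner ℂ (Ξ.1 n) D := by
    intro Ξ
    unfold pairing
    rw [tsum_eq_single n, L2.inner_def, integral_withDensity_eq_integral_toReal_smul (hdm _)
      (Eventually.of_forall fun k => ENNReal.ofReal_lt_top)]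
    · apply integral_congr_ae
      have h1 : (Φ.1 n : (Fin n → X) → ℂ) =ᵐ[power μ n] u := by
        have h2 : Φ.1 n = hu.toLp u := lp.single_apply_self _ _ _
        rw [h2]
        exact (withDensity_absolutelyContinuous' (hdm s).aemeasurable
          (Eventually.of_forall fun k => by
            have := Real.rpow_pos_of_pos (hW k) s
            simpa using this)).ae_le hu.coeFn_toLp
      filter_upwards [h1] with k hk
      rw [hk]
      have hp := fun t : ℝ => (Real.rpow_pos_of_pos (hW k) t)
      have h3 : ((weight ω k ^ (-s / 2) : ℝ) : ℂ) * ((weight ω k ^ (s / 2) : ℝ) : ℂ) = 1 := by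
        rw [← Complex.ofReal_mul, ← Real.rpow_add (hW k)]
        have : -s / 2 + s / 2 = 0 := by ring
        simp [this]
      simp only [u, map_mul, Complex.conj_ofReal, ENNReal.toReal_ofReal (hp _).le,
        Complex.real_smul, RCLike.inner_apply]
      linear_combination ((weight ω k ^ (-s) : ℝ) : ℂ) * D k * (starRingEnd ℂ) (Ξ.1 n k) * h3
    · intro j hj
      have h2 : Φ.1 j = 0 := lp.single_apply_ne _ _ _ hj
      rw [h2]
      have h4 : ((0 : Lp ℂ 2 (weightedPower μ ω s j)) : (Fin j → X) → ℂ) =ᵐ[power μ j] 0 := by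
        refine (withDensity_absolutelyContinuous' ?_ ?_).ae_le (Lp.coeFn_zero _ _ _)
        · have : Measurable (weight ω : (Fin j → X) → ℝ) := by
            unfold weight
            fun_prop
          exact (this.pow_const s).ennreal_ofReal.aemeasurable
        · refine Eventually.of_forall fun k => ?_
          have h5 : 0 ≤ ∑ i, ω (k i) := Finset.sum_nonneg fun i _ => hpos _
          have h6 : 0 < weight ω k := by
            unfold weight
            linarith
          have := Real.rpow_pos_of_pos h6 s
          simpa using this
      rw [integral_eq_zero_of_ae]
      filter_upwards [h4] with k hk
      rw [hk]
      simp
  have h7 : inner ℂ D D = 0 := by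
    have := h Φ
    rw [key, key] at this
    conv_lhs => rw [hD, inner_sub_left]
    rw [this, sub_self]
  exact sub_eq_zero.1 (inner_self_eq_zero.1 h7)

/-- There is at most one creation operator `a†(f) : F → F_{-s}`. -/
theorem IsCreation.unique {μ : Measure X} [SigmaFinite μ] {ω : X → ℝ} (hω : Measurable ω)
    (hpos : ∀ x, 0 ≤ ω x) {s : ℝ} {f : X → ℂ}
    {B B' : Fock μ →L[ℂ] FockS μ ω (-s)} (h : IsCreation f B) (h' : IsCreation f B') :
    B = B' := by
  obtain ⟨A, hA, hB⟩ := h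
  obtain ⟨A', hA', hB'⟩ := h'
  obtain rfl := hA.unique hA'
  ext Ψ : 1
  exact pairing_separates hω hpos fun Φ => by rw [← hB, ← hB']

end FockScale

end

noncomputable section

namespace FockScale

variable {X : Type*} [MeasurableSpace X]

/-! Everything rests on the bound `‖a(f)‖ ≤ ‖f‖_{-s}`. Inserting `ω^(-s/2) ω^(s/2) = 1` and applying
Cauchy–Schwarz in the last variable (`sq_lintegral_mul_le`) bounds `|∫ conj f Φ|²` by `‖f‖²_{-s} ∫
ω^s |Φ|²`. By symmetry of `Φ`, the factor `n + 1` turns the weight `ω^s` of the last variable into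
`∑ j, ω(k_j)^s`, which is at most `(1 + ∑ j, ω(k_j))^s` because `s ≥ 1` (`lintegral_last_le`).

Since `a(f) - a(g) = a(f - g)`, it remains to approximate `f` in `H_{-s}` by elements of `H`; the
restrictions of `f` to `{ω ≤ i}` do this by dominated convergence.

For creation operators, multiplication by the weight to the power `s` is a bounded map `U : F_s →
F_{-s}` turning the pairing into the scalar product of `F_s`. Hence `a†(f) = U ∘ a(f)*` with the
Hilbert space adjoint, and convergence of the `a(f^i)` passes to the `a†(f^i)`. -/

/-! ### Bounded operators between spaces of symmetric sequences -/

theorem eLpNorm_two_sq {Y : Type*} [MeasurableSpace Y] (ν : Measure Y) (g : Y → ℂ) :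
    eLpNorm g 2 ν ^ 2 = ∫⁻ k, ‖g k‖ₑ ^ 2 ∂ν := by
  have h := eLpNorm_nnreal_pow_eq_lintegral (μ := ν) (f := g) (p := 2) (by norm_num)
  have h2 : ((2 : NNReal) : ℝ) = ((2 : ℕ) : ℝ) := by norm_num
  simpa [h2, ENNReal.rpow_natCast] using h

theorem enorm_sq_eq_lintegral {Y : Type*} [MeasurableSpace Y] {ν : Measure Y} (g : Lp ℂ 2 ν) :
    ‖g‖ₑ ^ 2 = ∫⁻ k, ‖g k‖ₑ ^ 2 ∂ν := by
  rw [Lp.enorm_def, eLpNorm_two_sq]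

theorem isClosed_symmetricSum (ν : ∀ n : ℕ, Measure (Fin n → X))
    (hν : ∀ (n : ℕ) (σ : Equiv.Perm (Fin n)), MeasurePreserving (permute σ) (ν n) (ν n)) :
    IsClosed (symmetricSum ν hν : Set (lp (fun n : ℕ => Lp ℂ 2 (ν n)) 2)) := by
  have : (symmetricSum ν hν : Set (lp (fun n : ℕ => Lp ℂ 2 (ν n)) 2)) =
      ⋂ n, ⋂ σ : Equiv.Perm (Fin n),
        {Ψ | Lp.compMeasurePreserving (permute σ) (hν n σ) (Ψ n) = Ψ n} := by
    ext Ψ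
    simp [symmetricSum]
  rw [this]
  refine isClosed_iInter fun n => isClosed_iInter fun σ => ?_
  have hn : Continuous fun Ψ : lp (fun n : ℕ => Lp ℂ 2 (ν n)) 2 => Ψ n :=
    (lp.evalCLM ℂ (fun n : ℕ => Lp ℂ 2 (ν n)) 2 n).continuous
  exact isClosed_eq ((Lp.isometry_compMeasurePreserving (hν n σ)).continuous.comp hn) hn

/-- Completeness is what gives operators `F_s → F` a Hilbert space adjoint. -/
instance completeSpace_symmetricSum (ν : ∀ n : ℕ, Measure (Fin n → X))
    (hν : ∀ (n : ℕ) (σ : Equiv.Perm (Fin n)), MeasurePreserving (permute σ) (ν n) (ν n)) :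
    CompleteSpace (symmetricSum ν hν) :=
  (isClosed_symmetricSum ν hν).completeSpace_coe

theorem ae_symmetric {ν : ∀ n : ℕ, Measure (Fin n → X)}
    {hν : ∀ (n : ℕ) (σ : Equiv.Perm (Fin n)), MeasurePreserving (permute σ) (ν n) (ν n)}
    (Ψ : symmetricSum ν hν) (n : ℕ) (σ : Equiv.Perm (Fin n)) :
    (fun k => Ψ.1 n (permute σ k)) =ᵐ[ν n] Ψ.1 n := by
  have h := Lp.coeFn_compMeasurePreserving (Ψ.1 n) (hν n σ)
  rw [Ψ.2 n σ] at h
  exact h.symm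

/-- A family of functions `v Ψ n` that is linear, symmetric and bounded in `Ψ` defines a bounded
operator between spaces of sequences of symmetric functions. -/
theorem exists_operator {ν ν' : ∀ n : ℕ, Measure (Fin n → X)}
    {hν : ∀ (n : ℕ) (σ : Equiv.Perm (Fin n)), MeasurePreserving (permute σ) (ν n) (ν n)}
    {hν' : ∀ (n : ℕ) (σ : Equiv.Perm (Fin n)), MeasurePreserving (permute σ) (ν' n) (ν' n)}
    (v : symmetricSum ν hν → ∀ n : ℕ, (Fin n → X) → ℂ) (C : NNReal) (i : ℕ → ℕ)
    (hi : Function.Injective i)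
    (hmeas : ∀ Ψ n, AEStronglyMeasurable (v Ψ n) (ν' n))
    (hadd : ∀ Ψ Φ n, v (Ψ + Φ) n =ᵐ[ν' n] fun k => v Ψ n k + v Φ n k)
    (hsmul : ∀ (c : ℂ) Ψ n, v (c • Ψ) n =ᵐ[ν' n] fun k => c * v Ψ n k)
    (hsymm : ∀ Ψ n (σ : Equiv.Perm (Fin n)), (fun k => v Ψ n (permute σ k)) =ᵐ[ν' n] v Ψ n)
    (hbound : ∀ Ψ n, ∫⁻ k, ‖v Ψ n k‖ₑ ^ 2 ∂ν' n ≤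
      (C : ENNReal) ^ 2 * ∫⁻ k, ‖Ψ.1 (i n) k‖ₑ ^ 2 ∂ν (i n)) :
    ∃ A : symmetricSum ν hν →L[ℂ] symmetricSum ν' hν',
      (∀ Ψ n, (A Ψ).1 n =ᵐ[ν' n] v Ψ n) ∧ ‖A‖ ≤ C := by
  have hb : ∀ Ψ n, eLpNorm (v Ψ n) 2 (ν' n) ≤ C * ‖Ψ.1 (i n)‖ₑ := by
    intro Ψ n
    have h := hbound Ψ n
    rw [← eLpNorm_two_sq, ← enorm_sq_eq_lintegral, ← mul_pow] at h
    exact (ENNReal.pow_right_strictMono two_ne_zero).le_iff_le.1 h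
  have hmem : ∀ Ψ n, MemLp (v Ψ n) 2 (ν' n) := fun Ψ n =>
    ⟨hmeas Ψ n, (hb Ψ n).trans_lt (ENNReal.mul_lt_top ENNReal.coe_lt_top enorm_lt_top)⟩
  let u : symmetricSum ν hν → ∀ n : ℕ, Lp ℂ 2 (ν' n) := fun Ψ n => (hmem Ψ n).toLp _
  have hu : ∀ Ψ n, ‖u Ψ n‖ ≤ C * ‖Ψ.1 (i n)‖ := by
    intro Ψ n
    have h : ‖u Ψ n‖ₑ ≤ ‖(C : ℝ) * ‖Ψ.1 (i n)‖‖ₑ := by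
      rw [Lp.enorm_toLp, enorm_mul, enorm_norm]
      simpa using hb Ψ n
    have h2 := (enorm_le_iff_norm_le (x := u Ψ n) (y := (C : ℝ) * ‖Ψ.1 (i n)‖)).1 h
    simpa using h2
  have hsum : ∀ Ψ (s : Finset ℕ), ∑ n ∈ s, ‖u Ψ n‖ ^ (2 : ENNReal).toReal ≤
      (C * ‖Ψ‖) ^ (2 : ENNReal).toReal := by
    intro Ψ s
    -- Injectivity of `i` means that no sector of `Ψ` is counted twice, so the reindexed sum is a
    -- partial sum of `‖Ψ‖²`.
    have h := lp.sum_rpow_le_norm_rpow (p := 2) (by norm_num) Ψ.1 (s.map ⟨i, hi⟩)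
    simp only [ENNReal.toReal_ofNat, Real.rpow_ofNat, Finset.sum_map,
      Function.Embedding.coeFn_mk] at h ⊢
    calc ∑ n ∈ s, ‖u Ψ n‖ ^ 2 ≤ ∑ n ∈ s, (C * ‖Ψ.1 (i n)‖) ^ 2 :=
          Finset.sum_le_sum fun n _ => pow_le_pow_left₀ (norm_nonneg _) (hu Ψ n) 2
      _ = C ^ 2 * ∑ n ∈ s, ‖Ψ.1 (i n)‖ ^ 2 := by simp [mul_pow, Finset.mul_sum]
      _ ≤ C ^ 2 * ‖Ψ.1‖ ^ 2 := by gcongr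
      _ = (C * ‖Ψ‖) ^ 2 := by rw [mul_pow]; rfl
  let L : symmetricSum ν hν →ₗ[ℂ] symmetricSum ν' hν' :=
    { toFun := fun Ψ => ⟨⟨u Ψ, memℓp_gen' (hsum Ψ)⟩, by
        intro n σ
        change Lp.compMeasurePreserving (permute σ) (hν' n σ) (u Ψ n) = u Ψ n
        rw [Lp.toLp_compMeasurePreserving]
        exact MemLp.toLp_congr _ _ (hsymm Ψ n σ)⟩
      map_add' := fun Ψ Φ => by
        apply Subtype.ext
        apply lp.ext
        funext n
        change u (Ψ + Φ) n = u Ψ n + u Φ n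
        rw [← MemLp.toLp_add]
        exact MemLp.toLp_congr _ _ (hadd Ψ Φ n)
      map_smul' := fun c Ψ => by
        apply Subtype.ext
        apply lp.ext
        funext n
        change u (c • Ψ) n = c • u Ψ n
        rw [← MemLp.toLp_const_smul]
        exact MemLp.toLp_congr _ _ (hsmul c Ψ n) }
  refine ⟨L.mkContinuous C fun Ψ => ?_, fun Ψ n => (hmem Ψ n).coeFn_toLp,
    L.mkContinuous_norm_le C.2 _⟩
  exact lp.norm_le_of_forall_sum_le (f := (L Ψ).1) (by norm_num) (by positivity) (hsum Ψ)

/-! ### Splitting off the last variable -/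

theorem measurePreserving_snoc (μ : Measure X) [SigmaFinite μ] (n : ℕ) :
    MeasurePreserving (fun p : (Fin n → X) × X => (Fin.snoc p.1 p.2 : Fin (n + 1) → X))
      ((power μ n).prod μ) (power μ (n + 1)) := by
  have h := (measurePreserving_piFinSuccAbove (fun _ : Fin (n + 1) => μ) (Fin.last n)).symm
  have h2 := h.comp (Measure.measurePreserving_swap (μ := power μ n) (ν := μ))
  convert h2 using 1
  funext p
  exact (Fin.insertNth_last' (β := X) p.2 p.1).symm

theorem ae_ae_snoc {μ : Measure X} [SigmaFinite μ] {n : ℕ} {P : (Fin (n + 1) → X) → Prop}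
    (h : ∀ᵐ k ∂power μ (n + 1), P k) :
    ∀ᵐ k ∂power μ n, ∀ᵐ x ∂μ, P (Fin.snoc (α := fun _ => X) k x) :=
  Measure.ae_ae_of_ae_prod ((measurePreserving_snoc μ n).quasiMeasurePreserving.ae h)

theorem lintegral_snoc {μ : Measure X} [SigmaFinite μ] {n : ℕ} {G : (Fin (n + 1) → X) → ENNReal}
    (hG : Measurable G) :
    ∫⁻ k, ∫⁻ x, G (Fin.snoc (α := fun _ => X) k x) ∂μ ∂power μ n = ∫⁻ k, G k ∂power μ (n + 1) := by
  rw [← (measurePreserving_snoc μ n).lintegral_comp hG]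
  exact (lintegral_prod _ (hG.comp (measurePreserving_snoc μ n).measurable).aemeasurable).symm

/-! ### Comparing one-particle and many-particle weights -/

theorem weight_pos {X : Type*} {ω : X → ℝ} (hω : ∀ x, 0 ≤ ω x) {n : ℕ} (k : Fin n → X) : 0 < weight ω k := by
  have : 0 ≤ ∑ j, ω (k j) := Finset.sum_nonneg fun j _ => hω _
  unfold weight
  linarith

theorem measurable_weight {ω : X → ℝ} (hω : Measurable ω) (n : ℕ) :
    Measurable (weight ω : (Fin n → X) → ℝ) := by
  unfold weight
  fun_prop

theorem measurable_density {ω : X → ℝ} (hω : Measurable ω) (s : ℝ) (n : ℕ) :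
    Measurable fun k : Fin n → X => ENNReal.ofReal (weight ω k ^ s) :=
  ((measurable_weight hω n).pow_const s).ennreal_ofReal

/-- The density is strictly positive, so no null sets are gained. Almost everywhere statements can
then move between the spaces of the scale. -/
theorem ae_weightedPower (μ : Measure X) {ω : X → ℝ} (hω : Measurable ω) (hpos : ∀ x, 0 ≤ ω x)
    (s : ℝ) (n : ℕ) : ae (weightedPower μ ω s n) = ae (power μ n) := by
  refine le_antisymm (withDensity_absolutelyContinuous _ _).ae_le
    (withDensity_absolutelyContinuous' (measurable_density hω s n).aemeasurable
      (Eventually.of_forall fun k => ?_)).ae_le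
  have := Real.rpow_pos_of_pos (weight_pos hpos k) s
  simpa using this

theorem lintegral_weightedPower (μ : Measure X) {ω : X → ℝ} (hω : Measurable ω) (s : ℝ) (n : ℕ)
    {G : (Fin n → X) → ENNReal} (hG : Measurable G) :
    ∫⁻ k, G k ∂weightedPower μ ω s n =
      ∫⁻ k, ENNReal.ofReal (weight ω k ^ s) * G k ∂power μ n :=
  lintegral_withDensity_eq_lintegral_mul _ (measurable_density hω s n) hG

/-- Superadditivity of `t ↦ t ^ s`; this is where `s ≥ 1`, rather than just `s ≥ 0`, matters. -/
theorem sum_rpow_le_rpow_sum {ι : Type*} (t : Finset ι) (a : ι → ENNReal) {s : ℝ} (hs : 1 ≤ s) :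
    ∑ j ∈ t, a j ^ s ≤ (∑ j ∈ t, a j) ^ s := by
  classical
  induction t using Finset.induction_on with
  | empty => simp
  | insert j t hj ih =>
    rw [Finset.sum_insert hj, Finset.sum_insert hj]
    exact (add_le_add_right ih _).trans (ENNReal.add_rpow_le_rpow_add _ _ hs)

theorem sum_density_le {X : Type*} {ω : X → ℝ} (hpos : ∀ x, 0 ≤ ω x) {s : ℝ} (hs : 1 ≤ s) {n : ℕ}
    (k : Fin n → X) :
    ∑ j, ENNReal.ofReal (ω (k j) ^ s) ≤ ENNReal.ofReal (weight ω k ^ s) := by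
  have hs0 : 0 ≤ s := zero_le_one.trans hs
  simp only [← ENNReal.ofReal_rpow_of_nonneg (hpos _) hs0,
    ← ENNReal.ofReal_rpow_of_nonneg (weight_pos hpos k).le hs0]
  refine (sum_rpow_le_rpow_sum _ _ hs).trans (ENNReal.rpow_le_rpow ?_ hs0)
  rw [← ENNReal.ofReal_sum_of_nonneg fun j _ => hpos _]
  apply ENNReal.ofReal_le_ofReal
  unfold weight
  linarith

/-- The one-particle weight of the last variable is dominated, up to the number of variables, by
the many-particle weight. -/
theorem lintegral_last_le {μ : Measure X} [SigmaFinite μ] {ω : X → ℝ} (hω : Measurable ω)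
    (hpos : ∀ x, 0 ≤ ω x) {s : ℝ} (hs : 1 ≤ s) {n : ℕ} {Φ : (Fin (n + 1) → X) → ℂ}
    (hΦ : Measurable Φ)
    (hsymm : ∀ σ : Equiv.Perm (Fin (n + 1)), (fun k => Φ (permute σ k)) =ᵐ[power μ (n + 1)] Φ) :
    ((n : ENNReal) + 1) * ∫⁻ k, ∫⁻ x, ENNReal.ofReal (ω x ^ s) *
        ‖Φ (Fin.snoc (α := fun _ => X) k x)‖ₑ ^ 2 ∂μ ∂power μ n ≤
      ∫⁻ k, ‖Φ k‖ₑ ^ 2 ∂weightedPower μ ω s (n + 1) := by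
  have hm : ∀ j : Fin (n + 1), Measurable fun k : Fin (n + 1) → X =>
      ENNReal.ofReal (ω (k j) ^ s) * ‖Φ k‖ₑ ^ 2 := fun j =>
    (((hω.comp (measurable_pi_apply j)).pow_const s).ennreal_ofReal).mul (hΦ.enorm.pow_const 2)
  have h1 := lintegral_snoc (μ := μ) (hm (Fin.last n))
  simp only [Fin.snoc_last] at h1
  -- Exchanging `j` with the last variable changes neither the measure nor `Φ`, so `n + 1` copies of
  -- one integral become a sum over all variables.
  have h2 : ∀ j : Fin (n + 1),
      ∫⁻ k, ENNReal.ofReal (ω (k j) ^ s) * ‖Φ k‖ₑ ^ 2 ∂power μ (n + 1) =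
      ∫⁻ k, ENNReal.ofReal (ω (k (Fin.last n)) ^ s) * ‖Φ k‖ₑ ^ 2 ∂power μ (n + 1) := by
    intro j
    rw [← (measurePreserving_permute μ (n + 1) (Equiv.swap j (Fin.last n))).lintegral_comp (hm j)]
    apply lintegral_congr_ae
    filter_upwards [hsymm (Equiv.swap j (Fin.last n))] with k hk
    rw [hk]
    simp [permute]
  rw [h1, lintegral_weightedPower μ hω s _ (hΦ.enorm.pow_const 2)]
  calc _ = ∑ j : Fin (n + 1),
        ∫⁻ k, ENNReal.ofReal (ω (k j) ^ s) * ‖Φ k‖ₑ ^ 2 ∂power μ (n + 1) := by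
          rw [Finset.sum_congr rfl fun j _ => h2 j]
          simp
    _ = ∫⁻ k, ∑ j, ENNReal.ofReal (ω (k j) ^ s) * ‖Φ k‖ₑ ^ 2 ∂power μ (n + 1) :=
        (lintegral_finsetSum _ fun j _ => hm j).symm
    _ ≤ _ := by
        refine lintegral_mono fun k => ?_
        rw [← Finset.sum_mul]
        exact mul_le_mul_left (sum_density_le hpos hs k) _

/-! ### The norm bound for the annihilation operator -/

/-- The squared norm of `f` in the one-particle space of order `-s`. -/
def oneParticleSq (μ : Measure X) (ω : X → ℝ) (s : ℝ) (f : X → ℂ) : ENNReal :=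
  ∫⁻ x, ENNReal.ofReal (ω x ^ (-s)) * ‖f x‖ₑ ^ 2 ∂μ

theorem sq_lintegral_mul_le {μ : Measure X} {ω : X → ℝ} (hω : Measurable ω) (hpos : ∀ x, 0 < ω x)
    (s : ℝ) {f h : X → ℂ} (hf : Measurable f) (hh : Measurable h) :
    (∫⁻ x, ‖f x‖ₑ * ‖h x‖ₑ ∂μ) ^ 2 ≤
      oneParticleSq μ ω s f * ∫⁻ x, ENNReal.ofReal (ω x ^ s) * ‖h x‖ₑ ^ 2 ∂μ := by
  have hm : ∀ t : ℝ, Measurable fun x => ENNReal.ofReal (ω x ^ t) := fun t =>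
    (hω.pow_const t).ennreal_ofReal
  have hsq : ∀ (t : ℝ) x, ENNReal.ofReal (ω x ^ (t / 2)) ^ 2 = ENNReal.ofReal (ω x ^ t) := by
    intro t x
    rw [← ENNReal.ofReal_pow (Real.rpow_pos_of_pos (hpos x) _).le, ← Real.rpow_mul_natCast (hpos x).le]
    norm_num
  have h1 := ENNReal.lintegral_mul_le_Lp_mul_Lq μ Real.HolderConjugate.two_two
    (f := fun x => ENNReal.ofReal (ω x ^ (-s / 2)) * ‖f x‖ₑ)
    (g := fun x => ENNReal.ofReal (ω x ^ (s / 2)) * ‖h x‖ₑ)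
    ((hm _).mul hf.enorm).aemeasurable ((hm _).mul hh.enorm).aemeasurable
  simp only [Pi.mul_apply, ENNReal.rpow_ofNat, mul_pow, hsq] at h1
  have h2 : ∀ x, ENNReal.ofReal (ω x ^ (-s / 2)) * ‖f x‖ₑ *
      (ENNReal.ofReal (ω x ^ (s / 2)) * ‖h x‖ₑ) = ‖f x‖ₑ * ‖h x‖ₑ := by
    intro x
    have h3 : ENNReal.ofReal (ω x ^ (-s / 2)) * ENNReal.ofReal (ω x ^ (s / 2)) = 1 := by
      rw [← ENNReal.ofReal_mul (Real.rpow_pos_of_pos (hpos x) _).le, ← Real.rpow_add (hpos x)]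
      have : -s / 2 + s / 2 = 0 := by ring
      simp [this]
    rw [mul_mul_mul_comm, h3, one_mul]
  simp only [h2] at h1
  refine (pow_le_pow_left₀ zero_le h1 2).trans_eq ?_
  have h4 : ∀ a : ENNReal, (a ^ (1 / 2 : ℝ)) ^ 2 = a := by
    intro a
    rw [← ENNReal.rpow_natCast, ← ENNReal.rpow_mul]
    norm_num
  rw [mul_pow, h4, h4, oneParticleSq]

/-- The function `k ↦ √(n+1) ∫ conj (f x) Φ (k, x) dμ(x)`. -/
def annihilate (μ : Measure X) (f : X → ℂ) (n : ℕ) (Φ : (Fin (n + 1) → X) → ℂ)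
    (k : Fin n → X) : ℂ :=
  (√((n : ℝ) + 1) : ℂ) * ∫ x, (starRingEnd ℂ) (f x) * Φ (Fin.snoc (α := fun _ => X) k x) ∂μ

theorem measurable_snoc (n : ℕ) :
    Measurable fun p : (Fin n → X) × X => (Fin.snoc p.1 p.2 : Fin (n + 1) → X) := by
  refine measurable_pi_lambda _ fun i => ?_
  refine Fin.lastCases ?_ (fun j => ?_) i
  · simpa using measurable_snd
  · simp only [Fin.snoc_castSucc]
    exact (measurable_pi_apply j).comp measurable_fst

theorem stronglyMeasurable_annihilate (μ : Measure X) [SigmaFinite μ] {f : X → ℂ}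
    (hf : Measurable f) {n : ℕ} {Φ : (Fin (n + 1) → X) → ℂ} (hΦ : Measurable Φ) :
    StronglyMeasurable (annihilate μ f n Φ) := by
  refine StronglyMeasurable.const_mul ?_ _
  apply StronglyMeasurable.integral_prod_right
    (f := fun (k : Fin n → X) x => (starRingEnd ℂ) (f x) * Φ (Fin.snoc (α := fun _ => X) k x))
  apply Measurable.stronglyMeasurable
  exact (Complex.continuous_conj.measurable.comp (hf.comp measurable_snd)).mul
    (hΦ.comp (measurable_snoc n))

/-- The absolute values stand inside the inner integral so that one estimate yields both absolute
convergence for almost all `k` and the operator bound. -/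
theorem lintegral_sq_le {μ : Measure X} [SigmaFinite μ] {ω : X → ℝ} (hω : Measurable ω)
    (hpos : ∀ x, 0 < ω x) {s : ℝ} (hs : 1 ≤ s) {f : X → ℂ} (hf : Measurable f) {n : ℕ}
    {Φ : (Fin (n + 1) → X) → ℂ} (hΦ : Measurable Φ)
    (hsymm : ∀ σ : Equiv.Perm (Fin (n + 1)), (fun k => Φ (permute σ k)) =ᵐ[power μ (n + 1)] Φ) :
    ((n : ENNReal) + 1) *
        ∫⁻ k, (∫⁻ x, ‖f x‖ₑ * ‖Φ (Fin.snoc (α := fun _ => X) k x)‖ₑ ∂μ) ^ 2 ∂power μ n ≤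
      oneParticleSq μ ω s f * ∫⁻ k, ‖Φ k‖ₑ ^ 2 ∂weightedPower μ ω s (n + 1) := by
  refine le_trans ?_ (mul_le_mul_right (lintegral_last_le hω (fun x => (hpos x).le) hs hΦ hsymm) _)
  have hm : Measurable fun k : Fin n → X => ∫⁻ x, ENNReal.ofReal (ω x ^ s) *
      ‖Φ (Fin.snoc (α := fun _ => X) k x)‖ₑ ^ 2 ∂μ := by
    apply Measurable.lintegral_prod_right'
      (f := fun p : (Fin n → X) × X => ENNReal.ofReal (ω p.2 ^ s) *
        ‖Φ (Fin.snoc (α := fun _ => X) p.1 p.2)‖ₑ ^ 2)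
    exact (((hω.comp measurable_snd).pow_const s).ennreal_ofReal).mul
      ((hΦ.comp (measurable_snoc n)).enorm.pow_const 2)
  rw [mul_left_comm, ← lintegral_const_mul _ hm]
  refine mul_le_mul_right (lintegral_mono fun k => ?_) _
  exact sq_lintegral_mul_le hω hpos s hf
    (hΦ.comp ((measurable_snoc n).comp (measurable_const.prodMk measurable_id)))

theorem ae_integrable {μ : Measure X} [SigmaFinite μ] {ω : X → ℝ} (hω : Measurable ω)
    (hpos : ∀ x, 0 < ω x) {s : ℝ} (hs : 1 ≤ s) {f : X → ℂ} (hf : Measurable f)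
    (hfs : oneParticleSq μ ω s f ≠ ⊤) {n : ℕ}
    {Φ : (Fin (n + 1) → X) → ℂ} (hΦ : Measurable Φ)
    (hsymm : ∀ σ : Equiv.Perm (Fin (n + 1)), (fun k => Φ (permute σ k)) =ᵐ[power μ (n + 1)] Φ)
    (hfin : ∫⁻ k, ‖Φ k‖ₑ ^ 2 ∂weightedPower μ ω s (n + 1) ≠ ⊤) :
    ∀ᵐ k ∂power μ n,
      Integrable (fun x => (starRingEnd ℂ) (f x) * Φ (Fin.snoc (α := fun _ => X) k x)) μ := by
  have h1 := (lintegral_sq_le hω hpos hs hf hΦ hsymm).trans_lt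
    (ENNReal.mul_lt_top hfs.lt_top hfin.lt_top)
  have h2 : ∫⁻ k, (∫⁻ x, ‖f x‖ₑ * ‖Φ (Fin.snoc (α := fun _ => X) k x)‖ₑ ∂μ) ^ 2 ∂power μ n ≠ ⊤ := by
    refine ne_top_of_le_ne_top h1.ne ?_
    exact le_mul_of_one_le_left zero_le (by simp)
  have hm : Measurable fun k : Fin n → X =>
      ∫⁻ x, ‖f x‖ₑ * ‖Φ (Fin.snoc (α := fun _ => X) k x)‖ₑ ∂μ := by
    apply Measurable.lintegral_prod_right'
      (f := fun p : (Fin n → X) × X => ‖f p.2‖ₑ * ‖Φ (Fin.snoc (α := fun _ => X) p.1 p.2)‖ₑ)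
    exact (hf.comp measurable_snd).enorm.mul (hΦ.comp (measurable_snoc n)).enorm
  filter_upwards [ae_lt_top (hm.pow_const 2) h2] with k hk
  refine ⟨((Complex.continuous_conj.measurable.comp hf).mul (hΦ.comp
    ((measurable_snoc n).comp (measurable_const.prodMk measurable_id)))).aestronglyMeasurable, ?_⟩
  rw [HasFiniteIntegral]
  have h3 : ∀ x, ‖(starRingEnd ℂ) (f x) * Φ (Fin.snoc (α := fun _ => X) k x)‖ₑ =
      ‖f x‖ₑ * ‖Φ (Fin.snoc (α := fun _ => X) k x)‖ₑ := fun x => by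
    rw [enorm_mul, RCLike.enorm_conj]
  simp only [h3]
  simpa using hk

theorem lintegral_annihilate_sq_le {μ : Measure X} [SigmaFinite μ] {ω : X → ℝ} (hω : Measurable ω)
    (hpos : ∀ x, 0 < ω x) {s : ℝ} (hs : 1 ≤ s) {f : X → ℂ} (hf : Measurable f) {n : ℕ}
    {Φ : (Fin (n + 1) → X) → ℂ} (hΦ : Measurable Φ)
    (hsymm : ∀ σ : Equiv.Perm (Fin (n + 1)), (fun k => Φ (permute σ k)) =ᵐ[power μ (n + 1)] Φ) :
    ∫⁻ k, ‖annihilate μ f n Φ k‖ₑ ^ 2 ∂power μ n ≤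
      oneParticleSq μ ω s f * ∫⁻ k, ‖Φ k‖ₑ ^ 2 ∂weightedPower μ ω s (n + 1) := by
  refine le_trans ?_ (lintegral_sq_le hω hpos hs hf hΦ hsymm)
  rw [← lintegral_const_mul' _ _ (by simp)]
  refine lintegral_mono fun k => ?_
  have h1 : ‖(√((n : ℝ) + 1) : ℂ)‖ₑ ^ 2 = (n : ENNReal) + 1 := by
    rw [← ofReal_norm, ← ENNReal.ofReal_pow (norm_nonneg _), Complex.norm_real,
      Real.norm_of_nonneg (Real.sqrt_nonneg _), Real.sq_sqrt (by positivity),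
      ENNReal.ofReal_add (by positivity) zero_le_one]
    simp
  rw [annihilate, enorm_mul, mul_pow, h1]
  refine mul_le_mul_right (pow_le_pow_left₀ zero_le ((enorm_integral_le_lintegral_enorm _).trans_eq
    (lintegral_congr fun x => ?_)) 2) _
  rw [enorm_mul, RCLike.enorm_conj]

/-- Almost every slice of a null set is null, so the formula is well defined on classes. -/
theorem annihilate_congr {μ : Measure X} [SigmaFinite μ] (f : X → ℂ) {n : ℕ}
    {Φ Φ' : (Fin (n + 1) → X) → ℂ} (h : Φ =ᵐ[power μ (n + 1)] Φ') :
    annihilate μ f n Φ =ᵐ[power μ n] annihilate μ f n Φ' := by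
  filter_upwards [ae_ae_snoc h] with k hk
  rw [annihilate, annihilate]
  congr 1
  apply integral_congr_ae
  filter_upwards [hk] with x hx
  rw [hx]

/-- A permutation of the first `n` variables, as a permutation of `n + 1` variables. -/
def extendPerm {n : ℕ} (σ : Equiv.Perm (Fin n)) : Equiv.Perm (Fin (n + 1)) :=
  (finSuccEquivLast.trans (Equiv.optionCongr σ)).trans finSuccEquivLast.symm

/-- Lets `annihilate` inherit symmetry in `n` variables from symmetry in `n + 1`. -/
theorem snoc_permute {X : Type*} {n : ℕ} (σ : Equiv.Perm (Fin n)) (k : Fin n → X) (x : X) :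
    (Fin.snoc (permute σ k) x : Fin (n + 1) → X) = permute (extendPerm σ) (Fin.snoc k x) := by
  funext i
  refine Fin.lastCases ?_ (fun j => ?_) i <;> simp [permute, extendPerm]

theorem exists_isAnnihilation {μ : Measure X} [SigmaFinite μ] {ω : X → ℝ} (hω : Measurable ω)
    (hpos : ∀ x, 0 < ω x) {s : ℝ} (hs : 1 ≤ s) {f : X → ℂ} (hf : Measurable f) {C : NNReal}
    (hC : oneParticleSq μ ω s f ≤ (C : ENNReal) ^ 2) :
    ∃ A : FockS μ ω s →L[ℂ] Fock μ, IsAnnihilation f A ∧ ‖A‖ ≤ C := by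
  have hae : ∀ n, ae (weightedPower μ ω s n) = ae (power μ n) :=
    ae_weightedPower μ hω (fun x => (hpos x).le) s
  have hfs : oneParticleSq μ ω s f ≠ ⊤ :=
    ne_top_of_le_ne_top (ENNReal.pow_ne_top ENNReal.coe_ne_top) hC
  have hΨm : ∀ (Ψ : FockS μ ω s) n, Measurable (Ψ.1 n : (Fin n → X) → ℂ) := fun Ψ n =>
    (Lp.stronglyMeasurable (Ψ.1 n)).measurable
  have hsymm : ∀ (Ψ : FockS μ ω s) n (σ : Equiv.Perm (Fin n)),
      (fun k => Ψ.1 n (permute σ k)) =ᵐ[power μ n] Ψ.1 n := by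
    intro Ψ n σ
    have h := ae_symmetric Ψ n σ
    rwa [EventuallyEq, hae] at h
  have hfin : ∀ (Ψ : FockS μ ω s) n, ∫⁻ k, ‖Ψ.1 n k‖ₑ ^ 2 ∂weightedPower μ ω s n ≠ ⊤ := by
    intro Ψ n
    rw [← enorm_sq_eq_lintegral]
    exact ENNReal.pow_ne_top enorm_ne_top
  -- Serves both additivity in `Ψ` and the integrability clause of `IsAnnihilation`.
  have hint := fun (Ψ : FockS μ ω s) n =>
    ae_integrable hω hpos hs hf hfs (hΨm Ψ (n + 1)) (hsymm Ψ (n + 1)) (hfin Ψ (n + 1))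
  obtain ⟨A, hA, hAC⟩ := exists_operator (hν := measurePreserving_permute_weighted μ ω s)
    (hν' := measurePreserving_permute μ) (fun Ψ n => annihilate μ f n (Ψ.1 (n + 1))) C
    (fun n => n + 1) (add_left_injective 1)
    (fun Ψ n => (stronglyMeasurable_annihilate μ hf (hΨm Ψ (n + 1))).aestronglyMeasurable)
    (by
      intro Ψ Φ n
      have h : (Ψ + Φ).1 (n + 1) =ᵐ[power μ (n + 1)] Ψ.1 (n + 1) + Φ.1 (n + 1) := by
        have h := Lp.coeFn_add (Ψ.1 (n + 1)) (Φ.1 (n + 1))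
        rw [EventuallyEq, hae] at h
        exact h
      filter_upwards [annihilate_congr f h, hint Ψ n, hint Φ n] with k hk h1 h2
      rw [hk]
      simp only [annihilate, Pi.add_apply, mul_add]
      rw [integral_add h1 h2, mul_add])
    (by
      intro c Ψ n
      have h : (c • Ψ).1 (n + 1) =ᵐ[power μ (n + 1)] c • (Ψ.1 (n + 1) : (Fin (n + 1) → X) → ℂ) := by
        have h := Lp.coeFn_smul c (Ψ.1 (n + 1))
        rw [EventuallyEq, hae] at h
        exact h
      filter_upwards [annihilate_congr f h] with k hk
      rw [hk]
      simp only [annihilate, Pi.smul_apply, smul_eq_mul, mul_left_comm _ c]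
      rw [integral_const_mul, mul_left_comm])
    (by
      intro Ψ n σ
      filter_upwards [annihilate_congr f (hsymm Ψ (n + 1) (extendPerm σ))] with k hk
      rw [← hk]
      simp only [annihilate, snoc_permute])
    (by
      intro Ψ n
      exact (lintegral_annihilate_sq_le hω hpos hs hf (hΨm Ψ (n + 1)) (hsymm Ψ (n + 1))).trans
        (mul_le_mul_left hC _))
  refine ⟨A, fun Ψ n => ?_, hAC⟩
  filter_upwards [hA Ψ n, hint Ψ n] with k h1 h2
  exact ⟨h2, h1⟩

/-- With uniqueness, this reduces norm convergence of operators to convergence in `H_{-s}`. -/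
theorem IsAnnihilation.sub {μ : Measure X} [SigmaFinite μ] {ω : X → ℝ} {s : ℝ} {f g : X → ℂ}
    {A B : FockS μ ω s →L[ℂ] Fock μ} (hA : IsAnnihilation f A) (hB : IsAnnihilation g B) :
    IsAnnihilation (fun x => f x - g x) (A - B) := by
  intro Ψ n
  have h : ((A - B) Ψ).1 n =ᵐ[power μ n] (A Ψ).1 n - (B Ψ).1 n :=
    Lp.coeFn_sub ((A Ψ).1 n) ((B Ψ).1 n)
  filter_upwards [hA Ψ n, hB Ψ n, h] with k h1 h2 h3
  simp only [map_sub, sub_mul]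
  refine ⟨h1.1.sub h2.1, ?_⟩
  rw [h3, Pi.sub_apply, h1.2, h2.2, integral_sub h1.1 h2.1, mul_sub]

/-! ### From the duality pairing to the scalar product -/

/-- Multiplication by `(1 + ω(k₁) + ⋯ + ω(kₙ)) ^ s` maps `F_s` to `F_{-s}` and turns the duality
pairing into the scalar product of `F_s`. -/
theorem exists_pairing_eq_inner (μ : Measure X) [SigmaFinite μ] {ω : X → ℝ} (hω : Measurable ω)
    (hpos : ∀ x, 0 ≤ ω x) (s : ℝ) :
    ∃ U : FockS μ ω s →L[ℂ] FockS μ ω (-s),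
      ∀ Ξ Φ : FockS μ ω s, pairing (U Ξ) Φ = inner ℂ Ξ Φ := by
  have hae : ∀ t n, ae (weightedPower μ ω t n) = ae (power μ n) :=
    ae_weightedPower μ hω hpos
  have hW : ∀ n, Measurable fun k : Fin n → X => ((weight ω k ^ s : ℝ) : ℂ) := fun n =>
    Complex.measurable_ofReal.comp ((measurable_weight hω n).pow_const s)
  have hΨm : ∀ (Ψ : FockS μ ω s) n, Measurable (Ψ.1 n : (Fin n → X) → ℂ) := fun Ψ n =>
    (Lp.stronglyMeasurable (Ψ.1 n)).measurable
  obtain ⟨U, hU, -⟩ := exists_operator (hν := measurePreserving_permute_weighted μ ω s)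
    (hν' := measurePreserving_permute_weighted μ ω (-s))
    (fun Ψ n k => ((weight ω k ^ s : ℝ) : ℂ) * Ψ.1 n k) 1 id Function.injective_id
    (fun Ψ n => ((hW n).mul (hΨm Ψ n)).aestronglyMeasurable)
    (by
      intro Ψ Φ n
      have h := Lp.coeFn_add (Ψ.1 n) (Φ.1 n)
      rw [EventuallyEq, hae, ← hae (-s)] at h
      filter_upwards [h] with k hk
      rw [← mul_add]
      exact congrArg _ hk)
    (by
      intro c Ψ n
      have h := Lp.coeFn_smul c (Ψ.1 n)
      rw [EventuallyEq, hae, ← hae (-s)] at h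
      filter_upwards [h] with k hk
      rw [mul_left_comm]
      exact congrArg _ hk)
    (by
      intro Ψ n σ
      have h := ae_symmetric Ψ n σ
      rw [EventuallyEq, hae, ← hae (-s)] at h
      filter_upwards [h] with k hk
      rw [weight_permute, hk])
    (by
      intro Ψ n
      have hm : Measurable fun k => ‖((weight ω k ^ s : ℝ) : ℂ) * Ψ.1 n k‖ₑ ^ 2 :=
        ((hW n).mul (hΨm Ψ n)).enorm.pow_const 2
      rw [ENNReal.coe_one, one_pow, one_mul, id, lintegral_weightedPower μ hω _ _ hm,
        lintegral_weightedPower μ hω _ _ ((hΨm Ψ n).enorm.pow_const 2)]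
      -- With `W` the weight, `W^(-s) |W^s Ψ|² = W^s |Ψ|²`: equality holds, which is why the
      -- constant is `1`.
      refine (lintegral_congr fun k => ?_).le
      have hp := fun t : ℝ => Real.rpow_pos_of_pos (weight_pos hpos k) t
      have h1 : ‖((weight ω k ^ s : ℝ) : ℂ)‖ₑ = ENNReal.ofReal (weight ω k ^ s) := by
        rw [← ofReal_norm, Complex.norm_real, Real.norm_of_nonneg (hp s).le]
      have h2 : ENNReal.ofReal (weight ω k ^ (-s)) * ENNReal.ofReal (weight ω k ^ s) = 1 := by
        rw [← ENNReal.ofReal_mul (hp _).le, ← Real.rpow_add (weight_pos hpos k)]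
        simp
      rw [enorm_mul, mul_pow, h1, sq (ENNReal.ofReal _), ← mul_assoc, ← mul_assoc, h2, one_mul])
  refine ⟨U, fun Ξ Φ => ?_⟩
  rw [pairing, Submodule.coe_inner, lp.inner_eq_tsum]
  refine tsum_congr fun n => ?_
  rw [L2.inner_def, integral_withDensity_eq_integral_toReal_smul (measurable_density hω s n)
      (Eventually.of_forall fun k => ENNReal.ofReal_lt_top)]
  apply integral_congr_ae
  have h := hU Ξ n
  rw [EventuallyEq, hae] at h
  filter_upwards [h] with k hk
  rw [hk]
  have hp := fun t : ℝ => Real.rpow_pos_of_pos (weight_pos hpos k) t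
  have h3 : ((weight ω k ^ (-s / 2) : ℝ) : ℂ) * ((weight ω k ^ (s / 2) : ℝ) : ℂ) = 1 := by
    rw [← Complex.ofReal_mul, ← Real.rpow_add (weight_pos hpos k)]
    have : -s / 2 + s / 2 = 0 := by ring
    simp [this]
  simp only [map_mul, Complex.conj_ofReal, ENNReal.toReal_ofReal (hp _).le,
    Complex.real_smul, RCLike.inner_apply]
  linear_combination ((weight ω k ^ s : ℝ) : ℂ) * Φ.1 n k * (starRingEnd ℂ) (Ξ.1 n k) * h3

theorem exists_isAnnihilation_norm_le {μ : Measure X} [SigmaFinite μ] {ω : X → ℝ}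
    (hω : Measurable ω) (hpos : ∀ x, 0 < ω x) {s : ℝ} (hs : 1 ≤ s) {f : X → ℂ}
    (hf : Measurable f) (hfs : oneParticleSq μ ω s f ≠ ⊤) :
    ∃ A : FockS μ ω s →L[ℂ] Fock μ, IsAnnihilation f A ∧
      ‖A‖ ≤ NNReal.sqrt (oneParticleSq μ ω s f).toNNReal := by
  refine exists_isAnnihilation hω hpos hs hf ?_
  rw [← ENNReal.coe_pow, NNReal.sq_sqrt, ENNReal.coe_toNNReal hfs]

/-! ### Approximation of `f` by cutoffs -/

theorem oneParticleSq_ne_top {μ : Measure X} {ω : X → ℝ} (hω : Measurable ω) {s : ℝ}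
    (f : OneParticle μ ω (-s)) : oneParticleSq μ ω s f ≠ ⊤ := by
  have h1 := enorm_sq_eq_lintegral f
  rw [lintegral_withDensity_eq_lintegral_mul _ ((hω.pow_const (-s)).ennreal_ofReal)
    ((Lp.stronglyMeasurable f).measurable.enorm.pow_const 2)] at h1
  exact h1.symm.trans_ne (ENNReal.pow_ne_top enorm_ne_top)

theorem oneParticleSq_mono {μ : Measure X} {ω : X → ℝ} {s : ℝ} {f g : X → ℂ}
    (h : ∀ᵐ x ∂μ, ‖g x‖ₑ ≤ ‖f x‖ₑ) : oneParticleSq μ ω s g ≤ oneParticleSq μ ω s f := by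
  apply lintegral_mono_ae
  filter_upwards [h] with x hx
  gcongr

/-- The restriction of `f` to the set where `ω ≤ r`. -/
def cutoff (ω : X → ℝ) (f : X → ℂ) (r : ℝ) : X → ℂ := {x | ω x ≤ r}.indicator f

theorem measurable_cutoff {ω : X → ℝ} (hω : Measurable ω) {f : X → ℂ} (hf : Measurable f) (r : ℝ) :
    Measurable (cutoff ω f r) :=
  hf.indicator (measurableSet_le hω measurable_const)

/-- Where `ω ≤ r`, one has `1 ≤ r^s ω^(-s)`, so the unweighted norm is controlled by the norm of
order `-s`. -/
theorem memLp_cutoff {μ : Measure X} {ω : X → ℝ} (hω : Measurable ω) (hpos : ∀ x, 0 < ω x)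
    {s : ℝ} (hs : 0 ≤ s) {f : X → ℂ} (hf : Measurable f) (hfs : oneParticleSq μ ω s f ≠ ⊤)
    (r : ℝ) : MemLp (cutoff ω f r) 2 μ := by
  refine ⟨(measurable_cutoff hω hf r).aestronglyMeasurable, ?_⟩
  have h : ∫⁻ x, ‖cutoff ω f r x‖ₑ ^ 2 ∂μ ≤ ENNReal.ofReal (r ^ s) * oneParticleSq μ ω s f := by
    rw [oneParticleSq, ← lintegral_const_mul' _ _ ENNReal.ofReal_ne_top]
    refine lintegral_mono fun x => ?_
    by_cases hx : ω x ≤ r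
    · have h1 : 1 ≤ ENNReal.ofReal (r ^ s) * ENNReal.ofReal (ω x ^ (-s)) := by
        have h2 : 1 = ENNReal.ofReal (ω x ^ s) * ENNReal.ofReal (ω x ^ (-s)) := by
          rw [← ENNReal.ofReal_mul (Real.rpow_pos_of_pos (hpos x) _).le, ← Real.rpow_add (hpos x)]
          simp
        rw [h2]
        gcongr
        exact (hpos x).le
      rw [cutoff, Set.indicator_of_mem (show x ∈ {x | ω x ≤ r} from hx), ← mul_assoc]
      exact le_mul_of_one_le_left zero_le h1
    · rw [cutoff, Set.indicator_of_notMem (show x ∉ {x | ω x ≤ r} from hx)]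
      simp
  have h2 : eLpNorm (cutoff ω f r) 2 μ ^ 2 < ⊤ := by
    rw [eLpNorm_two_sq]
    exact h.trans_lt (ENNReal.mul_lt_top ENNReal.ofReal_lt_top hfs.lt_top)
  simpa using h2

/-- At each point the difference vanishes once `i ≥ ω x`; the integrable majorant is `ω^(-s) |f|²`.
-/
theorem tendsto_oneParticleSq_sub_cutoff {μ : Measure X} {ω : X → ℝ} (hω : Measurable ω) {s : ℝ}
    {f : X → ℂ} (hf : Measurable f) (hfs : oneParticleSq μ ω s f ≠ ⊤) :
    Tendsto (fun i : ℕ => oneParticleSq μ ω s fun x => f x - cutoff ω f i x) atTop (𝓝 0) := by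
  have h := tendsto_lintegral_of_dominated_convergence
    (F := fun (i : ℕ) x => ENNReal.ofReal (ω x ^ (-s)) * ‖f x - cutoff ω f i x‖ₑ ^ 2)
    (f := fun _ => 0) (μ := μ) (fun x => ENNReal.ofReal (ω x ^ (-s)) * ‖f x‖ₑ ^ 2)
    (fun i => ((hω.pow_const (-s)).ennreal_ofReal).mul
      ((hf.sub (measurable_cutoff hω hf i)).enorm.pow_const 2))
    (fun i => Eventually.of_forall fun x => by
      by_cases hx : x ∈ {x | ω x ≤ (i : ℝ)} <;> simp [cutoff, hx])
    hfs (Eventually.of_forall fun x => by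
      obtain ⟨N, hN⟩ := exists_nat_ge (ω x)
      refine tendsto_const_nhds.congr' ?_
      filter_upwards [eventually_ge_atTop N] with i hi
      have hx : x ∈ {x | ω x ≤ (i : ℝ)} := hN.trans (by exact_mod_cast hi)
      simp [cutoff, hx])
  rwa [lintegral_zero] at h

/-! ### Norm limits and conclusion -/

theorem tendsto_norm_sub_of_le {E F : Type*} [NormedAddCommGroup E] [NormedSpace ℂ E]
    [NormedAddCommGroup F] [NormedSpace ℂ F] {a : E →L[ℂ] F} {b : ℕ → E →L[ℂ] F}
    {r : ℕ → ℝ} (h : ∀ i, ‖a - b i‖ ≤ r i) (hr : Tendsto r atTop (𝓝 0)) :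
    Tendsto (fun i => ‖a - b i‖) atTop (𝓝 0) :=
  squeeze_zero (fun _ => norm_nonneg _) h hr

/-- Taking adjoints is isometric, and composing with the fixed `U` costs at most a factor `‖U‖`. -/
theorem tendsto_norm_comp_adjoint_sub {E F G : Type*} [NormedAddCommGroup E]
    [InnerProductSpace ℂ E] [CompleteSpace E] [NormedAddCommGroup F] [InnerProductSpace ℂ F]
    [CompleteSpace F] [NormedAddCommGroup G] [NormedSpace ℂ G] (U : E →L[ℂ] G) {a : E →L[ℂ] F}
    {b : ℕ → E →L[ℂ] F} (h : Tendsto (fun i => ‖a - b i‖) atTop (𝓝 0)) :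
    Tendsto (fun i => ‖U ∘L a.adjoint - U ∘L (b i).adjoint‖) atTop (𝓝 0) := by
  refine tendsto_norm_sub_of_le (fun i => ?_) (by simpa using h.const_mul ‖U‖)
  rw [← ContinuousLinearMap.comp_sub, ← map_sub]
  refine (ContinuousLinearMap.opNorm_comp_le _ _).trans_eq ?_
  rw [LinearIsometryEquiv.norm_map]

end FockScale

end

theorem proposition3p4 {X : Type*} [MeasurableSpace X] (μ : Measure X) [SigmaFinite μ]
    (ω : X → ℝ) (hω : Measurable ω) (m : ℝ) (hm : 0 < m) (hmω : ∀ x, m ≤ ω x)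
    (s : ℝ) (hs : 1 ≤ s) (f : FockScale.OneParticle μ ω (-s)) :
    ∃ (a : FockScale.FockS μ ω s →L[ℂ] FockScale.Fock μ)
      (c : FockScale.Fock μ →L[ℂ] FockScale.FockS μ ω (-s)),
      FockScale.IsAnnihilation f a ∧ FockScale.IsCreation f c ∧
      ∃ (g : ℕ → Lp ℂ 2 μ)
        (aᵢ : ℕ → FockScale.FockS μ ω s →L[ℂ] FockScale.Fock μ)
        (cᵢ : ℕ → FockScale.Fock μ →L[ℂ] FockScale.FockS μ ω (-s)),
        (∀ i, FockScale.IsAnnihilation (g i) (aᵢ i) ∧ FockScale.IsCreation (g i) (cᵢ i)) ∧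
        Tendsto (fun i => ‖a - aᵢ i‖) atTop (𝓝 0) ∧
        Tendsto (fun i => ‖c - cᵢ i‖) atTop (𝓝 0) := by
  have hpos : ∀ x, 0 < ω x := fun x => hm.trans_le (hmω x)
  have hf : Measurable f := (Lp.stronglyMeasurable f).measurable
  have hfs := FockScale.oneParticleSq_ne_top hω f
  let g : ℕ → Lp ℂ 2 μ := fun i =>
    (FockScale.memLp_cutoff hω hpos (zero_le_one.trans hs) hf hfs i).toLp
  have hg : ∀ i, g i =ᵐ[μ] FockScale.cutoff ω f i := fun i => MemLp.coeFn_toLp _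
  have hgm : ∀ i, Measurable (g i) := fun i => (Lp.stronglyMeasurable (g i)).measurable
  have hgs : ∀ i, FockScale.oneParticleSq μ ω s (g i) ≠ ⊤ := fun i => by
    refine ne_top_of_le_ne_top hfs (FockScale.oneParticleSq_mono ?_)
    filter_upwards [hg i] with x hx
    rw [hx]
    exact enorm_indicator_le_enorm_self _ _
  have hd : Tendsto (fun i => FockScale.oneParticleSq μ ω s fun x => f x - g i x)
      atTop (𝓝 0) := by
    refine (FockScale.tendsto_oneParticleSq_sub_cutoff hω hf hfs).congr fun i => ?_
    apply lintegral_congr_ae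
    filter_upwards [hg i] with x hx
    rw [hx]
  have hds : ∀ i, FockScale.oneParticleSq μ ω s (fun x => f x - g i x) ≠ ⊤ := fun i => by
    refine ne_top_of_le_ne_top hfs (FockScale.oneParticleSq_mono ?_)
    filter_upwards [hg i] with x hx
    rw [hx]
    by_cases h : x ∈ {x | ω x ≤ (i : ℝ)} <;> simp [FockScale.cutoff, h]
  obtain ⟨a, ha, -⟩ := FockScale.exists_isAnnihilation_norm_le hω hpos hs hf hfs
  choose b hb _ using fun i =>
    FockScale.exists_isAnnihilation_norm_le hω hpos hs (hgm i) (hgs i)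
  obtain ⟨U, hU⟩ := FockScale.exists_pairing_eq_inner μ hω (fun x => (hpos x).le) s
  -- `⟨Ψ, A Φ⟩ = ⟨A* Ψ, Φ⟩`, and `U` turns the latter, a scalar product in `F_s`, into the pairing.
  have hcreation : ∀ {h : X → ℂ} {A : FockScale.FockS μ ω s →L[ℂ] FockScale.Fock μ},
      FockScale.IsAnnihilation h A → FockScale.IsCreation h (U ∘L A.adjoint) := fun hA =>
    ⟨_, hA, fun Ψ Φ => by
      rw [ContinuousLinearMap.comp_apply, hU, ContinuousLinearMap.adjoint_inner_left]⟩
  have hnorm : Tendsto (fun i => ‖a - b i‖) atTop (𝓝 0) := by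
    have h1 : Tendsto (fun i => ((NNReal.sqrt
        (FockScale.oneParticleSq μ ω s fun x => f x - g i x).toNNReal : NNReal) : ℝ))
        atTop (𝓝 0) := by
      have h2 := (ENNReal.tendsto_toNNReal ENNReal.zero_ne_top).comp hd
      have h3 := (NNReal.continuous_coe.tendsto _).comp
        ((NNReal.sqrt.continuous.tendsto _).comp h2)
      simpa only [Function.comp_def, NNReal.sqrt_zero, NNReal.coe_zero, ENNReal.toNNReal_zero] using h3
    refine FockScale.tendsto_norm_sub_of_le (fun i => ?_) h1
    -- The operator built directly from `f - g i` obeys the norm bound, and by uniqueness it equals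
    -- `a - b i`.
    obtain ⟨A, hA, hAn⟩ := FockScale.exists_isAnnihilation_norm_le hω hpos hs
      (hf.sub (hgm i)) (hds i)
    rw [(ha.sub (hb i)).unique hA]
    exact hAn
  refine ⟨a, U ∘L a.adjoint, ha, hcreation ha, g, b, fun i => U ∘L (b i).adjoint,
    fun i => ⟨hb i, hcreation (hb i)⟩, hnorm, FockScale.tendsto_norm_comp_adjoint_sub U hnorm⟩
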